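/- Let $K$ be an algebraically closed field and let $G$ be a simple (linear) algebraic group over $K$, identified with its group of $K$-points: $G$ is connected, noncommutative, and has no closed connected normal subgroups other than $1$ and $G$. Let $n, r \ge 0$ and let $\omega = \omega(x_1,\dots,x_n,y_1,\dots,y_r)$ be a nontrivial element of the free group $F_{n+r}$ on $x_1,\dots,x_n,y_1,\dots,y_r$. For $\Sigma = (\sigma_1,\dots,\sigma_r)\in G^r$ let $$\widetilde{w}_\Sigma\colon G^n\to G,\qquad (g_1,\dots,g_n)\mapsto \omega(g_1,\dots,g_n,\sigma_1,\dots,\sigma_r),$$ be the corresponding word map with constants, and let $\dim \operatorname{Im}\widetilde{w}_\Sigma$ denote the dimension of the Zariski closure of its image in $G$. Then there exist an integer $\mathfrak{d}\ge 0$ and a nonempty Zariski open subset $U\subset G^r$ such that $$\dim \operatorname{Im}\widetilde{w}_\Sigma = \mathfrak{d}\quad\text{for all } \Sigma\in U, \qquad\text{and}\qquad \dim \operatorname{Im}\widetilde{w}_\Sigma \le \mathfrak{d}\quad\text{for all } \Sigma\in G^r.$$ -/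

import Mathlib

open scoped Topology

/-- The Zariski topology on the affine space `K^ι`: the closed sets are the zero loci of
ideals of polynomials. It is a plain definition, not an instance, since `ι → K` may carry the
product topology. -/
@[reducible] def zariskiTopology (K ι : Type*) [Field K] : TopologicalSpace (ι → K) :=
  TopologicalSpace.ofClosed
    {Z | ∃ I : Ideal (MvPolynomial ι K), Z = MvPolynomial.zeroLocus K I}
    ⟨⊤, by simp⟩
    (by
      intro A hA
      refine ⟨sSup {I | MvPolynomial.zeroLocus K I ∈ A}, Set.Subset.antisymm ?_ ?_⟩
      · intro x hx
        refine (MvPolynomial.le_zeroLocus_iff_le_vanishingIdeal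
          (V := {x})).2 (sSup_le fun I hI => ?_) rfl
        exact MvPolynomial.le_zeroLocus_iff_le_vanishingIdeal.1
          (Set.singleton_subset_iff.2 (hx _ hI))
      · intro x hx Z hZ
        obtain ⟨I, rfl⟩ := hA hZ
        exact MvPolynomial.zeroLocus_anti_mono (le_sSup hZ) hx)
    (by
      rintro _ ⟨I, rfl⟩ _ ⟨J, rfl⟩
      refine ⟨I * J, Set.Subset.antisymm ?_ ?_⟩
      · rintro x (hx | hx)
        · exact MvPolynomial.zeroLocus_anti_mono Ideal.mul_le_left hx
        · exact MvPolynomial.zeroLocus_anti_mono Ideal.mul_le_right hx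
      · intro x hx
        by_contra h
        simp only [Set.mem_union, MvPolynomial.mem_zeroLocus_iff, not_or, not_forall] at h
        obtain ⟨⟨p, hp, hp0⟩, q, hq, hq0⟩ := h
        have := hx _ (Ideal.mul_mem_mul hp hq)
        rw [map_mul] at this
        exact (mul_eq_zero.1 this).elim hp0 hq0)

/-- The dimension of a subset `S` of the affine space `K^ι`: the dimension of its Zariski
closure, that is, the Krull dimension of the coordinate ring `K[ι] / I(closure S)`. -/
noncomputable def zariskiDim {K ι : Type*} [Field K] (S : Set (ι → K)) : WithBot ℕ∞ :=
  ringKrullDim (MvPolynomial ι K ⧸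
    MvPolynomial.vanishingIdeal K (@closure _ (zariskiTopology K ι) S))

/-- A (linear, i.e. affine) algebraic group over an algebraically closed field `K`, identified
with its group of `K`-points: a Zariski closed subset of an affine space, with a group
structure whose multiplication and inversion are morphisms of affine varieties, i.e. are given
by polynomials in the coordinates. -/
structure AffineAlgebraicGroup (K : Type*) [Field K] where
  /-- the dimension of the ambient affine space -/
  m : ℕ
  /-- the set of points -/
  points : Set (Fin m → K)
  isClosed_points : IsClosed[zariskiTopology K (Fin m)] points
  /-- the group structure on the set of points -/
  group : Group points
  mul_regular : ∃ P : Fin m → MvPolynomial (Fin m ⊕ Fin m) K, ∀ (x y : points) (i : Fin m),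
    (x * y : points).1 i = MvPolynomial.eval (Sum.elim x.1 y.1) (P i)
  inv_regular : ∃ P : Fin m → MvPolynomial (Fin m) K, ∀ (x : points) (i : Fin m),
    (x⁻¹ : points).1 i = MvPolynomial.eval x.1 (P i)

namespace AffineAlgebraicGroup

attribute [instance] AffineAlgebraicGroup.group

variable {K : Type*} [Field K]

/-- A simple algebraic group: connected, noncommutative, and without closed connected normal
subgroups other than the trivial one and the whole group (the centre may be a nontrivial finite
group). For algebraic groups, connected means the same as irreducible, and it is
irreducibility that is written here. -/
structure IsSimple (G : AffineAlgebraicGroup K) : Prop where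
  irreducible : @IsIrreducible _ (zariskiTopology K (Fin G.m)) G.points
  noncommutative : ∃ x y : G.points, x * y ≠ y * x
  eq_bot_or_eq_top : ∀ N : Subgroup G.points, N.Normal →
    IsClosed[zariskiTopology K (Fin G.m)] (Subtype.val '' (N : Set G.points)) →
    @IsIrreducible _ (zariskiTopology K (Fin G.m)) (Subtype.val '' (N : Set G.points)) →
    N = ⊥ ∨ N = ⊤

/-- The Zariski topology on the variety `G^r`, induced from the affine space of dimension
`r * m` that contains it (it is finer than the product topology). -/
@[reducible] def powTopology (G : AffineAlgebraicGroup K) (r : ℕ) : TopologicalSpace (Fin r → G.points) :=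
  TopologicalSpace.induced (fun s (p : Fin r × Fin G.m) => (s p.1).1 p.2)
    (zariskiTopology K (Fin r × Fin G.m))

/-- The word map with constants `G^n → G`,
`(g₁, …, gₙ) ↦ ω(g₁, …, gₙ, σ₁, …, σᵣ)`. -/
def constWordMap (G : AffineAlgebraicGroup K) {n r : ℕ} (ω : FreeGroup (Fin (n + r)))
    (σ : Fin r → G.points) (g : Fin n → G.points) : G.points :=
  FreeGroup.lift (Fin.append g σ) ω

/-- The image of the word map with constants, as a subset of the affine space containing `G`. -/
def constWordImage (G : AffineAlgebraicGroup K) {n r : ℕ} (ω : FreeGroup (Fin (n + r)))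
    (σ : Fin r → G.points) : Set (Fin G.m → K) :=
  Subtype.val '' Set.range (G.constWordMap ω σ)

end AffineAlgebraicGroup

open scoped TensorProduct

/-! The closure of the image of the word map with parameter `σ` has coordinate ring `K[x₁, …, xₘ] ⊆
K[G^n]`, where the `xᵢ` are the matrix-like coordinates of the map. Its dimension is therefore the
largest size of an algebraically independent subfamily of the `xᵢ`. Only finitely many index sets
occur, so some `σ₀` attains the maximum `d` of these sizes, and the upper bound is immediate. What
remains is that independence of the subfamily chosen at `σ₀` persists on a nonempty open set.

This is `exists_forall_algebraicIndependent_specialize`. Over `A = K[G^r]` the coordinates are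
elements of `A ⊗ R`, `R = K[G^n]`, and `σ` is a specialization `A → K`. The subfamily at `σ₀` is
completed to a transcendence basis of `R` by elements not depending on the parameter. The completed
family is independent over `A`, since it is so at one point, and a count makes it a transcendence
basis of `A ⊗ R`. Generators of `R` then satisfy algebraic relations over it, which survive
specialization wherever one coefficient does not vanish. There the specialized family has `R`
algebraic over it and has `trdeg R` members, so it is independent. -/

/-! ### Krull dimension and transcendence degree. -/

/-- Incomparability gives `≤`; lying over and going up lift chains of primes and give `≥`. -/
theorem ringKrullDim_eq_of_isIntegral_of_injective {P S : Type*} [CommRing P] [CommRing S]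
    [IsDomain P] [Algebra P S] [Algebra.IsIntegral P S]
    (hinj : Function.Injective (algebraMap P S)) : ringKrullDim S = ringKrullDim P := by
  refine le_antisymm ?_ ?_
  · exact Order.krullDim_le_of_strictMono (PrimeSpectrum.comap (algebraMap P S))
      fun I J h => Ideal.IsIntegral.comap_lt_comap (R := P) (A := S) h
  · refine iSup_le fun l => ?_
    obtain ⟨Q, -, hQ, hQl⟩ := Ideal.exists_ideal_over_prime_of_isIntegral
      (R := P) (S := S) l.head.asIdeal ⊥ (by
        rw [← RingHom.ker_eq_comap_bot, (RingHom.injective_iff_ker_eq_bot _).1 hinj]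
        exact bot_le)
    have : Q.LiesOver l.head.asIdeal := ⟨hQl.symm⟩
    obtain ⟨L, hL, -⟩ := Ideal.exists_ltSeries_of_hasGoingUp (S := S) l Q
    rw [← hL]
    exact Order.LTSeries.length_le_krullDim L

/-- Noether normalization: both invariants agree with those of a polynomial ring in `s` variables.
-/
theorem trdeg_cast_eq_ringKrullDim (K R : Type*) [Field K] [CommRing R] [IsDomain R] [Algebra K R]
    [Algebra.FiniteType K R] :
    ∃ s : ℕ, ringKrullDim R = s ∧ Algebra.trdeg K R = s := by
  obtain ⟨s, g, hg, hint⟩ := exists_integral_inj_algHom_of_fg K R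
  refine ⟨s, ?_, ?_⟩
  · algebraize [g.toRingHom]
    have : Algebra.IsIntegral (MvPolynomial (Fin s) K) R := ⟨hint⟩
    rw [ringKrullDim_eq_of_isIntegral_of_injective (P := MvPolynomial (Fin s) K) hg,
      MvPolynomial.ringKrullDim_of_isNoetherianRing]
    simp
  · algebraize [g.toRingHom]
    have : Algebra.IsIntegral (MvPolynomial (Fin s) K) R := ⟨hint⟩
    have : IsScalarTower K (MvPolynomial (Fin s) K) R :=
      .of_algebraMap_eq fun x => (g.commutes x).symm
    have : FaithfulSMul (MvPolynomial (Fin s) K) R :=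
      (faithfulSMul_iff_algebraMap_injective _ _).2 hg
    apply Cardinal.lift_injective
    rw [← lift_trdeg_add_eq K (MvPolynomial (Fin s) K) R,
      trdeg_eq_zero (R := MvPolynomial (Fin s) K) (A := R), MvPolynomial.trdeg_of_isDomain]
    simp

/-- A transcendence basis can be chosen among the generators; `c` picks one index for each of its
members. -/
theorem exists_maximal_algebraicIndependent_ringKrullDim {K R ι : Type*} [Field K] [CommRing R]
    [IsDomain R] [Algebra K R] [Finite ι] (x : ι → R) (hx : Algebra.adjoin K (Set.range x) = ⊤) :
    ∃ I : Set ι, AlgebraicIndependent K (fun i : I => x i) ∧ ringKrullDim R = I.ncard ∧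
      ∀ J : Set ι, AlgebraicIndependent K (fun i : J => x i) → J.ncard ≤ I.ncard := by
  have hft : Algebra.FiniteType K R :=
    ⟨(Set.finite_range x).toFinset, by rw [Set.Finite.coe_toFinset, hx]⟩
  obtain ⟨s, hs, hst⟩ := trdeg_cast_eq_ringKrullDim K R
  have halg : Algebra.IsAlgebraic (Algebra.adjoin K (Set.range x)) R := by
    refine ⟨fun r => ?_⟩
    exact isAlgebraic_algebraMap (⟨r, hx ▸ Algebra.mem_top⟩ : Algebra.adjoin K (Set.range x))
  obtain ⟨u, hu, hub⟩ := exists_isTranscendenceBasis_subset (R := K) (Set.range x)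
  choose c hc using fun r : u => hu r.2
  have hcinj : Function.Injective c := fun a b h => Subtype.ext (by rw [← hc, ← hc, h])
  have hcard : ∀ J : Set ι, AlgebraicIndependent K (fun i : J => x i) → J.ncard ≤ s := by
    intro J hJ
    have := hJ.lift_cardinalMk_le_trdeg
    rw [hst, Cardinal.lift_natCast, ← Nat.cast_card, Cardinal.lift_natCast, Nat.cast_le] at this
    exact this
  have hI : (Set.range c).ncard = s := by
    have h1 := hub.cardinalMk_eq_trdeg
    have : Finite u := Finite.of_injective c hcinj
    rw [hst, ← Nat.cast_card, Nat.cast_inj] at h1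
    rw [← h1, ← Nat.card_range_of_injective hcinj]
    rfl
  refine ⟨Set.range c, ?_, by rw [hs, hI], by rwa [hI]⟩
  have := hub.1.comp (Equiv.ofInjective c hcinj).symm (Equiv.injective _)
  convert this with i
  obtain ⟨i, j, rfl⟩ := i
  rw [Function.comp_apply, Equiv.ofInjective_symm_apply, hc]

theorem exists_maximal_algebraicIndependent_ringKrullDim_of_injective {K R S ι : Type*} [Field K]
    [CommRing R] [IsDomain R] [Algebra K R] [CommRing S] [Algebra K S] [Finite ι] (x : ι → R)
    (φ : MvPolynomial ι K →ₐ[K] S) (hφ : Function.Surjective φ) (ψ : S →ₐ[K] R)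
    (hψ : Function.Injective ψ) (hx : ∀ i, ψ (φ (MvPolynomial.X i)) = x i) :
    ∃ I : Set ι, AlgebraicIndependent K (fun i : I => x i) ∧ ringKrullDim S = I.ncard ∧
      ∀ J : Set ι, AlgebraicIndependent K (fun i : J => x i) → J.ncard ≤ I.ncard := by
  have hS : IsDomain S := hψ.isDomain ψ.toRingHom
  have hgen : Algebra.adjoin K (Set.range fun i => φ (MvPolynomial.X i)) = ⊤ := by
    have h := congrArg (Subalgebra.map φ) (MvPolynomial.adjoin_range_X (R := K) (σ := ι))
    rw [AlgHom.map_adjoin, ← Set.range_comp, Algebra.map_top, (AlgHom.range_eq_top _).2 hφ] at h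
    exact h
  have hind (J : Set ι) : AlgebraicIndependent K (fun i : J => x i) ↔
      AlgebraicIndependent K (fun i : J => φ (MvPolynomial.X (i : ι))) := by
    have h : (fun i : J => x i) = ψ ∘ fun i : J => φ (MvPolynomial.X (i : ι)) :=
      funext fun i => (hx i).symm
    rw [h]
    exact ψ.algebraicIndependent_iff hψ
  obtain ⟨I, hI, hdim, hmax⟩ := exists_maximal_algebraicIndependent_ringKrullDim _ hgen
  exact ⟨I, (hind I).2 hI, hdim, fun J hJ => hmax J ((hind J).1 hJ)⟩

theorem exists_maximal_algebraicIndependent_ringKrullDim_ker {K R ι : Type*} [Field K]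
    [CommRing R] [IsDomain R] [Algebra K R] [Finite ι] (x : ι → R) :
    ∃ I : Set ι, AlgebraicIndependent K (fun i : I => x i) ∧
      ringKrullDim (MvPolynomial ι K ⧸ RingHom.ker (MvPolynomial.aeval (R := K) x)) = I.ncard ∧
      ∀ J : Set ι, AlgebraicIndependent K (fun i : J => x i) → J.ncard ≤ I.ncard := by
  let φ := Ideal.Quotient.mkₐ K (RingHom.ker (MvPolynomial.aeval (R := K) x))
  have hφ : Function.Surjective φ := Ideal.Quotient.mkₐ_surjective _ _
  let ψ := Ideal.kerLiftAlg (MvPolynomial.aeval (R := K) x)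
  have hψ : Function.Injective ψ := Ideal.kerLiftAlg_injective _
  have hx (i : ι) : ψ (φ (MvPolynomial.X i)) = x i := by
    have h : ψ (φ (MvPolynomial.X i)) = MvPolynomial.aeval (R := K) x (MvPolynomial.X i) := rfl
    rw [h, MvPolynomial.aeval_X]
  exact exists_maximal_algebraicIndependent_ringKrullDim_of_injective x φ hφ ψ hψ hx

/-! ### Specializing the parameters: nonvanishing and independence. -/

section Slice

variable {K A R : Type*} [Field K] [CommRing A] [CommRing R] [Algebra K A] [Algebra K R]

/-- The specialization `A ⊗ R → R` of a family of functions at a point of the parameter space. -/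
noncomputable def specialize (R : Type*) [CommRing R] [Algebra K R] (s : A →ₐ[K] K) :
    A ⊗[K] R →ₐ[K] R :=
  Algebra.TensorProduct.lift ((Algebra.ofId K R).comp s) (AlgHom.id K R) fun _ _ => .all _ _

@[simp]
theorem specialize_tmul (s : A →ₐ[K] K) (a : A) (r : R) :
    specialize R s (a ⊗ₜ r) = s a • r := by
  simp [specialize, Algebra.smul_def, Algebra.ofId_apply]

theorem specialize_algebraMap (s : A →ₐ[K] K) (a : A) :
    specialize R s (algebraMap A (A ⊗[K] R) a) = algebraMap K R (s a) := by
  rw [Algebra.TensorProduct.algebraMap_apply, specialize_tmul, Algebra.algebraMap_self_apply,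
    Algebra.algebraMap_eq_smul_one]

theorem specialize_includeRight (s : A →ₐ[K] K) (r : R) :
    specialize R s (Algebra.TensorProduct.includeRight r) = r := by
  simp [Algebra.TensorProduct.includeRight_apply]

/-- Extension of scalars of a linear functional on `R`. -/
noncomputable def sliceFunctional (A : Type*) [CommRing A] [Algebra K A] (φ : R →ₗ[K] K) :
    A ⊗[K] R →ₗ[A] A :=
  (TensorProduct.AlgebraTensorModule.rid K A A).toLinearMap ∘ₗ φ.baseChange A

theorem apply_sliceFunctional (s : A →ₐ[K] K) (φ : R →ₗ[K] K) (b : A ⊗[K] R) :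
    s (sliceFunctional A φ b) = φ (specialize R s b) := by
  induction b with
  | zero => simp
  | tmul a r => simp [sliceFunctional, mul_comm]
  | add x y hx hy => simp [hx, hy]

/-- A `K`-basis of `R` is an `A`-basis of `A ⊗ R`, so some coordinate of `b` is nonzero. -/
theorem exists_sliceFunctional_ne_zero {b : A ⊗[K] R} (hb : b ≠ 0) :
    ∃ φ : R →ₗ[K] K, sliceFunctional A φ b ≠ 0 := by
  by_contra! h
  let e := Module.Basis.ofVectorSpace K R
  refine hb ((Algebra.TensorProduct.basis A e).ext_elem fun i => ?_)
  rw [map_zero, Finsupp.zero_apply, ← h (e.coord i)]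
  generalize b = b
  induction b with
  | zero => simp
  | tmul a r => simp [sliceFunctional, Algebra.smul_def, mul_comm]
  | add x y hx hy => simp [hx, hy]

theorem exists_forall_specialize_ne_zero {b : A ⊗[K] R} (hb : b ≠ 0) :
    ∃ a : A, a ≠ 0 ∧ ∀ s : A →ₐ[K] K, s a ≠ 0 → specialize R s b ≠ 0 := by
  obtain ⟨φ, hφ⟩ := exists_sliceFunctional_ne_zero hb
  refine ⟨_, hφ, fun s hs h => hs ?_⟩
  rw [apply_sliceFunctional, h, map_zero]

/-- Two nonzero factors both stay nonzero at a common point `s`, where their product is nonzero in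
the domain `R`. -/
theorem isDomain_tensorProduct_of_separating [IsDomain A] [IsDomain R]
    (hA : ∀ a : A, a ≠ 0 → ∃ s : A →ₐ[K] K, s a ≠ 0) : IsDomain (A ⊗[K] R) := by
  have : NoZeroDivisors (A ⊗[K] R) := by
    refine ⟨fun {x y} hxy => ?_⟩
    by_contra! h
    obtain ⟨a, ha, hax⟩ := exists_forall_specialize_ne_zero h.1
    obtain ⟨c, hc, hcy⟩ := exists_forall_specialize_ne_zero h.2
    obtain ⟨s, hs⟩ := hA _ (mul_ne_zero ha hc)
    rw [map_mul] at hs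
    refine mul_ne_zero (hax s (left_ne_zero_of_mul hs)) (hcy s (right_ne_zero_of_mul hs)) ?_
    rw [← map_mul, hxy, map_zero]
  have : Nontrivial (A ⊗[K] R) := by
    obtain ⟨s, -⟩ := hA 1 one_ne_zero
    exact (specialize R s).toRingHom.domain_nontrivial
  exact NoZeroDivisors.to_isDomain _

/-- Functionals dual to the specialized vectors, extended to `A`, give a matrix that specializes to
the identity; its determinant is therefore nonzero in `A`. -/
theorem linearIndependent_of_specialize [IsDomain A] {κ : Type*} (v : κ → A ⊗[K] R)
    (s : A →ₐ[K] K) (hv : LinearIndependent K fun k => specialize R s (v k)) :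
    LinearIndependent A v := by
  classical
  rw [linearIndependent_iff_finset_linearIndependent] at hv ⊢
  intro T
  obtain ⟨g, hg⟩ := LinearMap.exists_leftInverse_of_injective _
    (LinearMap.ker_eq_bot.2 (hv T))
  let M : Matrix T T A := fun j i => sliceFunctional A (Finsupp.lapply j ∘ₗ g) (v i)
  have hM : M.map s = 1 := by
    ext j i
    have := LinearMap.congr_fun hg (Finsupp.single i 1)
    simp only [LinearMap.comp_apply, Finsupp.linearCombination_single, one_smul,
      LinearMap.id_apply, Function.comp_apply] at this
    rw [Matrix.map_apply]
    simp [M, apply_sliceFunctional, this, Matrix.one_apply, Finsupp.single_apply, eq_comm]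
  have hdet : M.det ≠ 0 := by
    intro h
    have := congrArg Matrix.det hM
    rw [← AlgHom.mapMatrix_apply, ← AlgHom.map_det, h] at this
    simp at this
  rw [Fintype.linearIndependent_iff]
  intro c hc
  refine congrFun (Matrix.eq_zero_of_mulVec_eq_zero (v := c) hdet ?_)
  ext j
  have := congrArg (sliceFunctional A (Finsupp.lapply j ∘ₗ g)) hc
  rw [map_sum, map_zero] at this
  rw [Matrix.mulVec, dotProduct, Pi.zero_apply, ← this]
  refine Finset.sum_congr rfl fun i _ => ?_
  rw [map_smul, smul_eq_mul, mul_comm]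
  rfl

theorem algebraicIndependent_iff_linearIndependent_monomials {S B ι : Type*} [CommRing S]
    [CommRing B] [Algebra S B] (y : ι → B) : AlgebraicIndependent S y ↔
      LinearIndependent S fun m : ι →₀ ℕ => m.prod fun i k => y i ^ k := by
  have h : (fun m : ι →₀ ℕ => m.prod fun i k => y i ^ k) =
      (MvPolynomial.aeval (R := S) y).toLinearMap ∘ MvPolynomial.basisMonomials ι S := by
    ext m
    simp [MvPolynomial.aeval_monomial]
  rw [h]
  constructor
  · intro hy
    exact (MvPolynomial.basisMonomials ι S).linearIndependent.map' _ (LinearMap.ker_eq_bot.2 hy)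
  · intro hl
    rw [algebraicIndependent_iff]
    intro p hp
    apply (MvPolynomial.basisMonomials ι S).repr.injective
    rw [map_zero]
    refine linearIndependent_iff.1 hl _ ?_
    have h2 : Finsupp.linearCombination S
        ((MvPolynomial.aeval (R := S) y).toLinearMap ∘ MvPolynomial.basisMonomials ι S) =
        (MvPolynomial.aeval (R := S) y).toLinearMap ∘ₗ
          Finsupp.linearCombination S (MvPolynomial.basisMonomials ι S) := by
      ext; simp
    rw [h2, LinearMap.comp_apply, Module.Basis.linearCombination_repr]
    exact hp

theorem algebraicIndependent_of_specialize [IsDomain A] {ι : Type*} (y : ι → A ⊗[K] R)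
    (s : A →ₐ[K] K) (hy : AlgebraicIndependent K fun i => specialize R s (y i)) :
    AlgebraicIndependent A y := by
  rw [algebraicIndependent_iff_linearIndependent_monomials] at hy ⊢
  refine linearIndependent_of_specialize _ s ?_
  simpa [Finsupp.prod, map_prod] using hy

end Slice

/-! ### Algebraic relations under specialization. -/

section Core

variable {K A R : Type*} [Field K] [CommRing A] [CommRing R] [Algebra K A] [Algebra K R]

theorem isAlgebraic_of_forall_mem_adjoin_eq_top {C S : Type*} [CommRing C] [IsDomain C]
    [CommRing S] [Algebra C S] [Algebra K S] [Algebra K C] [IsScalarTower K C S] {t : Set S}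
    (ht : Algebra.adjoin K t = ⊤) (h : ∀ x ∈ t, IsAlgebraic C x) : Algebra.IsAlgebraic C S := by
  refine ⟨fun x => ?_⟩
  have hle : Algebra.adjoin K t ≤ (Subalgebra.algebraicClosure C S).restrictScalars K :=
    Algebra.adjoin_le h
  exact hle (ht ▸ Algebra.mem_top : x ∈ Algebra.adjoin K t)

theorem specialize_mem_adjoin {ι : Type*} (y : ι → A ⊗[K] R) (s : A →ₐ[K] K) {b : A ⊗[K] R}
    (hb : b ∈ Algebra.adjoin A (Set.range y)) :
    specialize R s b ∈ Algebra.adjoin K (Set.range fun i => specialize R s (y i)) := by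
  induction hb using Algebra.adjoin_induction with
  | mem b hb =>
    obtain ⟨i, rfl⟩ := hb
    exact Algebra.subset_adjoin ⟨i, rfl⟩
  | algebraMap a =>
    rw [specialize_algebraMap]
    exact Subalgebra.algebraMap_mem _ _
  | add x y _ _ hx hy => rw [map_add]; exact add_mem hx hy
  | mul x y _ _ hx hy => rw [map_mul]; exact mul_mem hx hy

/-- Specialization, restricted to the algebras generated by a family and by its
specializations. -/
noncomputable def specializeAdjoin {ι : Type*} (y : ι → A ⊗[K] R) (s : A →ₐ[K] K) :
    Algebra.adjoin A (Set.range y) →+*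
      Algebra.adjoin K (Set.range fun i => specialize R s (y i)) where
  toFun b := ⟨specialize R s b, specialize_mem_adjoin y s b.2⟩
  map_one' := Subtype.ext (map_one _)
  map_zero' := Subtype.ext (map_zero _)
  map_add' _ _ := Subtype.ext (map_add _ _ _)
  map_mul' _ _ := Subtype.ext (map_mul _ _ _)

/-- An algebraic relation specializes to a nontrivial one as long as one fixed nonzero coefficient
survives; `a` controls that coefficient. -/
theorem exists_forall_isAlgebraic_specialize {ι : Type*} (y : ι → A ⊗[K] R) (r : A ⊗[K] R)
    (hr : IsAlgebraic (Algebra.adjoin A (Set.range y)) r) :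
    ∃ a : A, a ≠ 0 ∧ ∀ s : A →ₐ[K] K, s a ≠ 0 →
      IsAlgebraic (Algebra.adjoin K (Set.range fun i => specialize R s (y i)))
        (specialize R s r) := by
  obtain ⟨P, hP, hPr⟩ := hr
  obtain ⟨k, hk⟩ : ∃ k, P.coeff k ≠ 0 := by
    by_contra! h
    exact hP (Polynomial.ext h)
  obtain ⟨a, ha, has⟩ := exists_forall_specialize_ne_zero (fun h => hk (Subtype.ext h))
  refine ⟨a, ha, fun s hs => ⟨P.map (specializeAdjoin y s), fun h => has s hs ?_, ?_⟩⟩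
  · have := congrArg (fun Q => ((Q.coeff k : Algebra.adjoin K _) : R)) h
    simp only [Polynomial.coeff_map, Polynomial.coeff_zero] at this
    exact this
  · rw [Polynomial.aeval_def, Polynomial.eval₂_map]
    have : (algebraMap (Algebra.adjoin K (Set.range fun i => specialize R s (y i))) R).comp
        (specializeAdjoin y s) = (specialize R s).toRingHom.comp (algebraMap _ _) := rfl
    rw [this, ← map_zero (specialize R s), ← hPr, Polynomial.aeval_def]
    exact (Polynomial.hom_eval₂ P _ (specialize R s).toRingHom r).symm

theorem isAlgebraic_tensorProduct_adjoin [IsDomain A] [IsDomain (A ⊗[K] R)] (u : Set R)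
    [Algebra.IsAlgebraic (Algebra.adjoin K u) R] :
    Algebra.IsAlgebraic (Algebra.adjoin A
      ((Algebra.TensorProduct.includeRight : R →ₐ[K] A ⊗[K] R) '' u)) (A ⊗[K] R) := by
  have hinj : Function.Injective (Algebra.TensorProduct.includeRight : R →ₐ[K] A ⊗[K] R) :=
    Algebra.TensorProduct.includeRight_injective (algebraMap K A).injective
  refine ⟨fun b => ?_⟩
  induction b with
  | zero => exact isAlgebraic_zero
  | add x y hx hy => exact hx.add hy
  | tmul a r =>
    have hr : IsAlgebraic (Algebra.adjoin A
        ((Algebra.TensorProduct.includeRight : R →ₐ[K] A ⊗[K] R) '' u))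
        ((Algebra.TensorProduct.includeRight : R →ₐ[K] A ⊗[K] R) r) := by
      have hmem : ∀ c ∈ Algebra.adjoin K u,
          (Algebra.TensorProduct.includeRight : R →ₐ[K] A ⊗[K] R) c ∈ Algebra.adjoin A
            ((Algebra.TensorProduct.includeRight : R →ₐ[K] A ⊗[K] R) '' u) := by
        have : Algebra.adjoin K u ≤ ((Algebra.adjoin A
            ((Algebra.TensorProduct.includeRight : R →ₐ[K] A ⊗[K] R) '' u)).restrictScalars
              K).comap Algebra.TensorProduct.includeRight :=
          Algebra.adjoin_le fun c hc => Algebra.subset_adjoin ⟨c, hc, rfl⟩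
        exact this
      let ψ : Algebra.adjoin K u →+* Algebra.adjoin A
          ((Algebra.TensorProduct.includeRight : R →ₐ[K] A ⊗[K] R) '' u) :=
        { toFun := fun c => ⟨_, hmem c c.2⟩
          map_one' := Subtype.ext (map_one _)
          map_zero' := Subtype.ext (map_zero _)
          map_add' := fun _ _ => Subtype.ext (map_add _ _ _)
          map_mul' := fun _ _ => Subtype.ext (map_mul _ _ _) }
      refine IsAlgebraic.ringHom_of_comp_eq ψ
        (Algebra.TensorProduct.includeRight : R →ₐ[K] A ⊗[K] R)
        (Algebra.IsAlgebraic.isAlgebraic r) (fun c d hcd => ?_) rfl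
      exact Subtype.ext (hinj (congrArg Subtype.val hcd))
    have ha : IsAlgebraic (Algebra.adjoin A
        ((Algebra.TensorProduct.includeRight : R →ₐ[K] A ⊗[K] R) '' u))
        (algebraMap A (A ⊗[K] R) a) :=
      isAlgebraic_algebraMap (algebraMap A (Algebra.adjoin A _) a)
    have := ha.mul hr
    simpa using this

end Core

/-- Algebraic independence of a family of functions depending on parameters is an open condition
on the parameters. -/
theorem exists_forall_algebraicIndependent_specialize {K A : Type*} {R : Type*} [Field K]
    [CommRing A] [CommRing R] [Algebra K A] [Algebra K R] [IsDomain A] [IsDomain R]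
    [Algebra.FiniteType K R] (hA : ∀ a : A, a ≠ 0 → ∃ s : A →ₐ[K] K, s a ≠ 0) {ι : Type*}
    [Finite ι] (f : ι → A ⊗[K] R) (s₀ : A →ₐ[K] K)
    (hf : AlgebraicIndependent K fun i => specialize R s₀ (f i)) :
    ∃ a : A, a ≠ 0 ∧ ∀ s : A →ₐ[K] K, s a ≠ 0 →
      AlgebraicIndependent K fun i => specialize R s (f i) := by
  classical
  have hB := isDomain_tensorProduct_of_separating (R := R) hA
  obtain ⟨u, hfu, -, hu⟩ := exists_isTranscendenceBasis_between (R := K)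
    (Set.range fun i => specialize R s₀ (f i)) Set.univ (Set.subset_univ _) hf.to_subtype_range
    (ht := by
      rw [Algebra.adjoin_univ]
      exact ⟨fun x => isAlgebraic_algebraMap (⟨x, Algebra.mem_top⟩ : (⊤ : Subalgebra K R))⟩)
  have hufin : Finite u := by
    rw [← Cardinal.mk_lt_aleph0_iff, hu.cardinalMk_eq_trdeg]
    exact trdeg_lt_aleph0_of_finiteType
  let e : ι ⊕ ↥(u \ Set.range fun i => specialize R s₀ (f i)) ≃ u :=
    (Equiv.sumCongr (Equiv.ofInjective _ hf.injective) (Equiv.refl _)).trans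
      (Equiv.Set.sumDiffSubset hfu)
  -- Only the members coming from `f` vary with the parameter; the rest of the basis `u` is kept
  -- constant.
  let y : ι ⊕ ↥(u \ Set.range fun i => specialize R s₀ (f i)) → A ⊗[K] R :=
    Sum.elim f fun j => Algebra.TensorProduct.includeRight (j : R)
  have hys₀ : AlgebraicIndependent K fun k => specialize R s₀ (y k) := by
    convert hu.1.comp e e.injective with k
    obtain k | k := k
    · rfl
    · exact specialize_includeRight _ _
  have hy := algebraicIndependent_of_specialize y s₀ hys₀
  have hualg := hu.isAlgebraic
  rw [Subtype.range_coe] at hualg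
  have hbasis : IsTranscendenceBasis A y := by
    have := isAlgebraic_tensorProduct_adjoin (K := K) (A := A) u
    -- `A ⊗ R` is algebraic over `A[u]`, so its transcendence degree is at most `|u|`, the size of
    -- `y`.
    refine hy.isTranscendenceBasis_of_lift_trdeg_le_of_finite ?_
    have h1 := Algebra.IsAlgebraic.trdeg_le_cardinalMk A
      ((Algebra.TensorProduct.includeRight : R →ₐ[K] A ⊗[K] R) '' u)
    refine (Cardinal.lift_le.2 h1).trans ?_
    have := Finite.of_equiv _ e.symm
    rw [← Nat.cast_card, ← Nat.cast_card, Cardinal.lift_natCast, Cardinal.lift_natCast,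
      Nat.cast_le, Nat.card_congr e]
    exact Set.ncard_image_le (Set.toFinite u)
  have hyalg := hbasis.isAlgebraic
  obtain ⟨t, ht⟩ := Algebra.FiniteType.out (R := K) (A := R)
  choose a ha has using fun r : R => exists_forall_isAlgebraic_specialize y
    (Algebra.TensorProduct.includeRight r) (hyalg.isAlgebraic _)
  -- Off the zeros of this product every generator of `R` stays algebraic over the specialized
  -- family.
  refine ⟨∏ r ∈ t, a r, Finset.prod_ne_zero_iff.2 fun r _ => ha r, fun s hs => ?_⟩
  rw [map_prod, Finset.prod_ne_zero_iff] at hs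
  have hsalg : Algebra.IsAlgebraic
      (Algebra.adjoin K (Set.range fun i => specialize R s (y i))) R := by
    refine isAlgebraic_of_forall_mem_adjoin_eq_top ht fun r hr => ?_
    simpa only [specialize_includeRight] using has r s (hs r hr)
  have hyfin := Finite.of_equiv _ e.symm
  have hsb : IsTranscendenceBasis K fun i => specialize R s (y i) := by
    refine Algebra.IsAlgebraic.isTranscendenceBasis_of_lift_le_trdeg_of_finite K _ ?_
    rw [← hu.cardinalMk_eq_trdeg, ← Nat.cast_card, ← Nat.cast_card, Cardinal.lift_natCast,
      Cardinal.lift_natCast, Nat.cast_le, Nat.card_congr e]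
  exact hsb.1.comp Sum.inl Sum.inl_injective

/-! ### Coordinate rings and irreducibility. -/

section Zariski

variable {K ι : Type*} [Field K]

theorem isClosed_zariskiTopology_iff {Z : Set (ι → K)} :
    IsClosed[zariskiTopology K ι] Z ↔
      ∃ I : Ideal (MvPolynomial ι K), Z = MvPolynomial.zeroLocus K I := by
  rw [← @isOpen_compl_iff _ _ (zariskiTopology K ι)]
  change Zᶜᶜ ∈ _ ↔ _
  rw [compl_compl]
  rfl

theorem isOpen_zariskiTopology_ne_zero (p : MvPolynomial ι K) :
    IsOpen[zariskiTopology K ι] {x | MvPolynomial.aeval x p ≠ 0} := by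
  rw [← @isClosed_compl_iff _ (zariskiTopology K ι), isClosed_zariskiTopology_iff]
  refine ⟨Ideal.span {p}, ?_⟩
  ext x
  simp [MvPolynomial.zeroLocus_span]

theorem vanishingIdeal_closure_zariskiTopology (S : Set (ι → K)) :
    MvPolynomial.vanishingIdeal K (@closure _ (zariskiTopology K ι) S) =
      MvPolynomial.vanishingIdeal K S := by
  refine le_antisymm (MvPolynomial.vanishingIdeal_anti_mono
    (@subset_closure _ (zariskiTopology K ι) S)) ?_
  rw [← MvPolynomial.le_zeroLocus_iff_le_vanishingIdeal]
  have hc : IsClosed[zariskiTopology K ι]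
      (MvPolynomial.zeroLocus K (MvPolynomial.vanishingIdeal K S)) :=
    isClosed_zariskiTopology_iff.2 ⟨_, rfl⟩
  let := zariskiTopology K ι
  exact closure_minimal (MvPolynomial.zeroLocus_vanishingIdeal_le S) hc

theorem zariskiDim_eq_ringKrullDim (S : Set (ι → K)) :
    zariskiDim S = ringKrullDim (MvPolynomial ι K ⧸ MvPolynomial.vanishingIdeal K S) := by
  rw [zariskiDim, vanishingIdeal_closure_zariskiTopology]

/-- The coordinate ring of (the closure of) a set of points. -/
abbrev coordinateRing (V : Set (ι → K)) : Type _ :=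
  MvPolynomial ι K ⧸ MvPolynomial.vanishingIdeal K V

/-- Evaluation of regular functions at a point. -/
noncomputable def coordinateRingEval {V : Set (ι → K)} {x : ι → K} (hx : x ∈ V) :
    coordinateRing V →ₐ[K] K :=
  Ideal.Quotient.liftₐ _ (MvPolynomial.aeval x) fun _ hp => hp x hx

@[simp]
theorem coordinateRingEval_mk {V : Set (ι → K)} {x : ι → K} (hx : x ∈ V)
    (p : MvPolynomial ι K) :
    coordinateRingEval hx (Ideal.Quotient.mk _ p) = MvPolynomial.aeval x p := rfl

theorem coordinateRing_eq_zero_iff {V : Set (ι → K)} {f : coordinateRing V} :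
    f = 0 ↔ ∀ x (hx : x ∈ V), coordinateRingEval hx f = 0 := by
  obtain ⟨p, rfl⟩ := Ideal.Quotient.mk_surjective f
  exact Ideal.Quotient.eq_zero_iff_mem

/-- Irreducibility of a set of points, in terms of polynomials. -/
def NonvanishingMeet (V : Set (ι → K)) : Prop :=
  ∀ p q : MvPolynomial ι K, (∃ x ∈ V, MvPolynomial.aeval x p ≠ 0) →
    (∃ x ∈ V, MvPolynomial.aeval x q ≠ 0) →
    ∃ x ∈ V, MvPolynomial.aeval x p ≠ 0 ∧ MvPolynomial.aeval x q ≠ 0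

theorem nonvanishingMeet_of_isIrreducible {V : Set (ι → K)}
    (hV : @IsIrreducible _ (zariskiTopology K ι) V) : NonvanishingMeet V :=
  fun p q hp hq => hV.2 _ _ (isOpen_zariskiTopology_ne_zero p)
    (isOpen_zariskiTopology_ne_zero q) hp hq

theorem NonvanishingMeet.isDomain_coordinateRing {V : Set (ι → K)} (hV : NonvanishingMeet V)
    (hne : V.Nonempty) : IsDomain (coordinateRing V) := by
  rw [Ideal.Quotient.isDomain_iff_prime, Ideal.isPrime_iff]
  constructor
  · obtain ⟨x, hx⟩ := hne
    rw [Ideal.ne_top_iff_one]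
    intro h
    simpa using h x hx
  · intro p q hpq
    by_contra! h
    simp only [MvPolynomial.mem_vanishingIdeal_iff, not_forall] at h hpq
    obtain ⟨⟨x, hx, hxp⟩, y, hy, hyq⟩ := h
    obtain ⟨z, hz, hzp, hzq⟩ := hV p q ⟨x, hx, hxp⟩ ⟨y, hy, hyq⟩
    have := hpq z hz
    rw [map_mul] at this
    exact mul_ne_zero hzp hzq this

end Zariski

/-! ### Powers of `G` and word maps as regular functions. -/

namespace AffineAlgebraicGroup

variable {K : Type*} [Field K] (G : AffineAlgebraicGroup K)

/-- The coordinates of a tuple of elements of `G`. -/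
def tupleCoord {r : ℕ} (s : Fin r → G.points) : Fin r × Fin G.m → K :=
  fun p => (s p.1).1 p.2

/-- The variety `G^r` as a set of points of affine space. -/
def tupleSet (r : ℕ) : Set (Fin r × Fin G.m → K) :=
  Set.range (G.tupleCoord (r := r))

theorem tupleCoord_mem_tupleSet {r : ℕ} (s : Fin r → G.points) :
    G.tupleCoord s ∈ G.tupleSet r := ⟨s, rfl⟩

theorem tupleSet_nonempty (r : ℕ) : (G.tupleSet r).Nonempty :=
  ⟨_, G.tupleCoord_mem_tupleSet 1⟩

/-- Slicing: with the tails of the two witnesses fixed, irreducibility of `G` gives a common first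
entry; with that entry fixed, induction gives a common tail. -/
theorem nonvanishingMeet_tupleSet (hG : NonvanishingMeet G.points) (r : ℕ) :
    NonvanishingMeet (G.tupleSet r) := by
  induction r with
  | zero =>
    rintro p q ⟨_, ⟨s, rfl⟩, hp⟩ ⟨_, ⟨t, rfl⟩, hq⟩
    refine ⟨_, ⟨s, rfl⟩, hp, ?_⟩
    rwa [Subsingleton.elim s t]
  | succ r ih =>
    rintro p q ⟨_, ⟨s, rfl⟩, hp⟩ ⟨_, ⟨t, rfl⟩, hq⟩
    let headSlice (τ : Fin r → G.points) : MvPolynomial (Fin (r + 1) × Fin G.m) K →ₐ[K]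
        MvPolynomial (Fin G.m) K :=
      MvPolynomial.aeval fun k => Fin.cases (motive := fun _ => MvPolynomial (Fin G.m) K)
        (MvPolynomial.X k.2) (fun i => MvPolynomial.C ((τ i).1 k.2)) k.1
    let tailSlice (g : G.points) : MvPolynomial (Fin (r + 1) × Fin G.m) K →ₐ[K]
        MvPolynomial (Fin r × Fin G.m) K :=
      MvPolynomial.aeval fun k => Fin.cases
        (motive := fun _ => MvPolynomial (Fin r × Fin G.m) K)
        (MvPolynomial.C (g.1 k.2)) (fun i => MvPolynomial.X (i, k.2)) k.1
    have hhead (τ : Fin r → G.points) (g : G.points) (p : MvPolynomial _ K) :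
        MvPolynomial.aeval g.1 (headSlice τ p) =
          MvPolynomial.aeval (G.tupleCoord (Fin.cons g τ : Fin (r + 1) → G.points)) p := by
      rw [← AlgHom.comp_apply]
      congr 1
      ext ⟨i, j⟩
      refine Fin.cases ?_ (fun i => ?_) i <;> simp [headSlice, tupleCoord]
    have htail (τ : Fin r → G.points) (g : G.points) (p : MvPolynomial _ K) :
        MvPolynomial.aeval (G.tupleCoord τ) (tailSlice g p) =
          MvPolynomial.aeval (G.tupleCoord (Fin.cons g τ : Fin (r + 1) → G.points)) p := by
      rw [← AlgHom.comp_apply]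
      congr 1
      ext ⟨i, j⟩
      refine Fin.cases ?_ (fun i => ?_) i <;> simp [tailSlice, tupleCoord]
    rw [← Fin.cons_self_tail s, ← hhead] at hp
    rw [← Fin.cons_self_tail t, ← hhead] at hq
    obtain ⟨g, hg, hgp, hgq⟩ := hG _ _ ⟨_, (s 0).2, hp⟩ ⟨_, (t 0).2, hq⟩
    lift g to G.points using hg
    rw [hhead, ← htail] at hgp hgq
    obtain ⟨_, ⟨τ, rfl⟩, hτp, hτq⟩ := ih _ _ ⟨_, ⟨_, rfl⟩, hgp⟩ ⟨_, ⟨_, rfl⟩, hgq⟩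
    rw [htail] at hτp hτq
    exact ⟨_, ⟨_, rfl⟩, hτp, hτq⟩

theorem isOpen_powTopology_ne_zero {r : ℕ} (a : coordinateRing (G.tupleSet r)) :
    IsOpen[G.powTopology r]
      {σ | coordinateRingEval (G.tupleCoord_mem_tupleSet σ) a ≠ 0} := by
  obtain ⟨p, rfl⟩ := Ideal.Quotient.mk_surjective a
  exact @isOpen_induced_iff _ _ (zariskiTopology K _) _ _ |>.2
    ⟨_, isOpen_zariskiTopology_ne_zero p, rfl⟩

theorem exists_polynomial_word {N : ℕ} (ω : FreeGroup (Fin N)) :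
    ∃ q : Fin G.m → MvPolynomial (Fin N × Fin G.m) K, ∀ (h : Fin N → G.points) (i : Fin G.m),
      (FreeGroup.lift h ω).1 i = MvPolynomial.aeval (G.tupleCoord h) (q i) := by
  have hinv (w : FreeGroup (Fin N)) (hw : ∃ q : Fin G.m → MvPolynomial (Fin N × Fin G.m) K,
      ∀ (h : Fin N → G.points) (i : Fin G.m),
        (FreeGroup.lift h w).1 i = MvPolynomial.aeval (G.tupleCoord h) (q i)) :
      ∃ q : Fin G.m → MvPolynomial (Fin N × Fin G.m) K,
      ∀ (h : Fin N → G.points) (i : Fin G.m),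
        (FreeGroup.lift h w⁻¹).1 i = MvPolynomial.aeval (G.tupleCoord h) (q i) := by
    obtain ⟨q, hq⟩ := hw
    obtain ⟨P, hP⟩ := G.inv_regular
    refine ⟨fun i => MvPolynomial.aeval q (P i), fun h i => ?_⟩
    rw [map_inv, hP, ← AlgHom.comp_apply, MvPolynomial.comp_aeval, MvPolynomial.aeval_eq_eval]
    simp only [← hq]
  induction ω using FreeGroup.induction_on with
  | C1 => exact ⟨fun i => MvPolynomial.C ((1 : G.points).1 i), fun h i => by simp⟩
  | of k => exact ⟨fun i => MvPolynomial.X (k, i), fun h i => by simp [tupleCoord]⟩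
  | inv_of k ih => exact hinv _ ih
  | mul w₁ w₂ h₁ h₂ =>
    obtain ⟨q₁, hq₁⟩ := h₁
    obtain ⟨q₂, hq₂⟩ := h₂
    obtain ⟨P, hP⟩ := G.mul_regular
    refine ⟨fun i => MvPolynomial.aeval (Sum.elim q₁ q₂) (P i), fun h i => ?_⟩
    rw [map_mul, hP, ← AlgHom.comp_apply, MvPolynomial.comp_aeval, MvPolynomial.aeval_eq_eval]
    congr 2
    ext (j | j)
    · exact hq₁ h j
    · exact hq₂ h j

/-- A word map with constants, as a family of regular functions on `G^n` with parameters
in `G^r`. -/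
theorem exists_regular_constWordMap {n r : ℕ} (ω : FreeGroup (Fin (n + r))) :
    ∃ f : Fin G.m → coordinateRing (G.tupleSet r) ⊗[K] coordinateRing (G.tupleSet n),
      ∀ (σ : Fin r → G.points) (g : Fin n → G.points) (i : Fin G.m),
        coordinateRingEval (G.tupleCoord_mem_tupleSet g)
          (specialize _ (coordinateRingEval (G.tupleCoord_mem_tupleSet σ)) (f i)) =
        (G.constWordMap ω σ g).1 i := by
  obtain ⟨q, hq⟩ := G.exists_polynomial_word ω
  let v : Fin (n + r) × Fin G.m →
      coordinateRing (G.tupleSet r) ⊗[K] coordinateRing (G.tupleSet n) := fun k =>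
    Fin.addCases (motive := fun _ => _)
      (fun i => 1 ⊗ₜ Ideal.Quotient.mk _ (MvPolynomial.X (i, k.2)))
      (fun i => Ideal.Quotient.mk _ (MvPolynomial.X (i, k.2)) ⊗ₜ 1) k.1
  refine ⟨fun i => MvPolynomial.aeval v (q i), fun σ g i => ?_⟩
  rw [constWordMap, hq, ← AlgHom.comp_apply, ← AlgHom.comp_apply]
  congr 1
  ext ⟨i, j⟩
  refine Fin.addCases (fun i => ?_) (fun i => ?_) i <;>
    simp [v, tupleCoord]

/-- A polynomial vanishes on the image exactly when its pullback is zero at every point of `G^n`,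
that is, zero in the coordinate ring. -/
theorem ker_aeval_eq_vanishingIdeal_constWordImage {n r : ℕ} (ω : FreeGroup (Fin (n + r)))
    (σ : Fin r → G.points) (x : Fin G.m → coordinateRing (G.tupleSet n))
    (hx : ∀ (g : Fin n → G.points) (i : Fin G.m),
      coordinateRingEval (G.tupleCoord_mem_tupleSet g) (x i) = (G.constWordMap ω σ g).1 i) :
    RingHom.ker (MvPolynomial.aeval (R := K) x) =
      MvPolynomial.vanishingIdeal K (G.constWordImage ω σ) := by
  have key (p : MvPolynomial (Fin G.m) K) (g : Fin n → G.points) :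
      coordinateRingEval (G.tupleCoord_mem_tupleSet g) (MvPolynomial.aeval x p) =
        MvPolynomial.aeval (G.constWordMap ω σ g).1 p := by
    rw [← AlgHom.comp_apply, MvPolynomial.comp_aeval]
    simp only [hx]
  ext p
  rw [RingHom.mem_ker, coordinateRing_eq_zero_iff, MvPolynomial.mem_vanishingIdeal_iff]
  constructor
  · rintro h _ ⟨_, ⟨g, rfl⟩, rfl⟩
    rw [← key, h]
  · rintro h _ ⟨g, rfl⟩
    exact (key p g).trans (h _ ⟨_, ⟨g, rfl⟩, rfl⟩)

theorem exists_maximal_algebraicIndependent_zariskiDim {n r : ℕ} (ω : FreeGroup (Fin (n + r)))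
    (σ : Fin r → G.points) [IsDomain (coordinateRing (G.tupleSet n))]
    (x : Fin G.m → coordinateRing (G.tupleSet n))
    (hx : ∀ (g : Fin n → G.points) (i : Fin G.m),
      coordinateRingEval (G.tupleCoord_mem_tupleSet g) (x i) = (G.constWordMap ω σ g).1 i) :
    ∃ I : Set (Fin G.m), AlgebraicIndependent K (fun i : I => x i) ∧
      zariskiDim (G.constWordImage ω σ) = I.ncard ∧
      ∀ J : Set (Fin G.m), AlgebraicIndependent K (fun i : J => x i) → J.ncard ≤ I.ncard := by
  rw [zariskiDim_eq_ringKrullDim, ← G.ker_aeval_eq_vanishingIdeal_constWordImage ω σ x hx]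
  exact exists_maximal_algebraicIndependent_ringKrullDim_ker x

end AffineAlgebraicGroup

/-! ### The generic dimension. -/

theorem theorem4p1 {K : Type*} [Field K] [IsAlgClosed K] (G : AffineAlgebraicGroup K)
    (hG : G.IsSimple) (n r : ℕ) (ω : FreeGroup (Fin (n + r))) (hω : ω ≠ 1) :
    ∃ (d : ℕ) (U : Set (Fin r → G.points)),
      IsOpen[G.powTopology r] U ∧ U.Nonempty ∧
      (∀ σ ∈ U, zariskiDim (G.constWordImage ω σ) = d) ∧
      ∀ σ : Fin r → G.points, zariskiDim (G.constWordImage ω σ) ≤ d := by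
  have hirr := nonvanishingMeet_of_isIrreducible hG.irreducible
  have hR : IsDomain (coordinateRing (G.tupleSet n)) :=
    (G.nonvanishingMeet_tupleSet hirr n).isDomain_coordinateRing (G.tupleSet_nonempty n)
  have hA : IsDomain (coordinateRing (G.tupleSet r)) :=
    (G.nonvanishingMeet_tupleSet hirr r).isDomain_coordinateRing (G.tupleSet_nonempty r)
  obtain ⟨f, hf⟩ := G.exists_regular_constWordMap ω
  choose I hI hdim hmax using fun σ : Fin r → G.points =>
    G.exists_maximal_algebraicIndependent_zariskiDim ω σ _ (hf σ)
  -- The maximum exists because `I` takes values in the finite set of subsets of `Fin G.m`.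
  obtain ⟨_, ⟨σ₀, rfl⟩, hσ₀⟩ : ∃ J ∈ Set.range I, ∀ J' ∈ Set.range I, J'.ncard ≤ J.ncard :=
    Set.exists_max_image _ _ (Set.toFinite _) (Set.range_nonempty I)
  have hnonvanishing (a : coordinateRing (G.tupleSet r)) (ha : a ≠ 0) :
      ∃ σ, coordinateRingEval (G.tupleCoord_mem_tupleSet σ) a ≠ 0 := by
    by_contra! h
    refine ha (coordinateRing_eq_zero_iff.2 ?_)
    rintro _ ⟨σ, rfl⟩
    exact h σ
  obtain ⟨a, ha, hind⟩ := exists_forall_algebraicIndependent_specialize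
    (fun a ha => (hnonvanishing a ha).imp' (fun σ =>
      coordinateRingEval (G.tupleCoord_mem_tupleSet σ)) fun _ h => h)
    (fun i : I σ₀ => f i) _ (hI σ₀)
  refine ⟨(I σ₀).ncard, _, G.isOpen_powTopology_ne_zero a, hnonvanishing a ha,
    fun σ hσ => ?_, fun σ => ?_⟩
  -- On `U` the index set `I σ₀` is still independent, so it bounds the dimension at `σ` from below.
  · rw [hdim σ, le_antisymm (hσ₀ _ ⟨σ, rfl⟩) (hmax σ _ (hind _ hσ))]
  · rw [hdim σ]
    exact_mod_cast hσ₀ _ ⟨σ, rfl⟩
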